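/- Let $k$ be an algebraically closed field of characteristic zero, let $G$ be a finite group with trivial center, and let $H \subseteq G$ be an abelian subgroup with character group $\widehat H = \operatorname{Hom}(H, k^*)$. For $\chi \in \widehat H$ put $e_\chi = \frac{1}{|H|}\sum_{h \in H} \chi(h^{-1})\, h \in kG$. Let $\omega : \widehat H \times \widehat H \to k^*$ be a normalized 2-cocycle, i.e. $\omega(\alpha\beta,\gamma)\,\omega(\alpha,\beta) = \omega(\alpha,\beta\gamma)\,\omega(\beta,\gamma)$ and $\omega(1,\alpha) = \omega(\alpha,1) = 1$ for all $\alpha,\beta,\gamma \in \widehat H$, and let $$J = \sum_{\alpha,\beta \in \widehat H} \omega(\alpha,\beta)\, e_\alpha \otimes e_\beta \in kG \otimes kG$$ be the corresponding twist. Let $A = (kG)^J$ be the twisted Hopf algebra, that is, the algebra $kG$ with its counit, with comultiplication $\Delta^J(x) = J^{-1}\Delta(x)J$ and with antipode $S^J(x) = v^{-1}S(x)v$, where $v = m(S \otimes \mathrm{id})(J)$. Let $A^*$ be the dual Hopf algebra, $G(A^*)$ its group of group-like elements, and $Z(A^*)$ its center. Suppose that $\omega$ is non-degenerate, i.e. that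 the only $\alpha \in \widehat H$ with $\omega(\alpha,\beta) = \omega(\beta,\alpha)$ for all $\beta \in \widehat H$ is $\alpha = 1$. Then $|H|$ divides the index $[A^* : G(A^*) \cap Z(A^*)]$, that is, the dimension of the Hopf subalgebra $k(G(A^*) \cap Z(A^*))$ divides $\dim A^*$, and $|H|$ divides the integer $\dim A^* / \dim k(G(A^*) \cap Z(A^*))$. -/

import Mathlib

open scoped TensorProduct

noncomputable section

set_option linter.unusedSectionVars false

/-! ### Twists of a bialgebra and the twisted bialgebra -/

/-- A twist of a bialgebra `A`: an invertible `J ∈ A ⊗ A` such that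
`(Δ ⊗ id)(J) (J ⊗ 1) = (id ⊗ Δ)(J) (1 ⊗ J)` and `(ε ⊗ id)(J) = (id ⊗ ε)(J) = 1`. -/
structure HopfTwist (k A : Type*) [CommRing k] [Ring A] [Bialgebra k A] where
  val : (A ⊗[k] A)ˣ
  cocycle :
    Algebra.TensorProduct.assoc k k k A A A
      (Algebra.TensorProduct.map (Bialgebra.comulAlgHom k A) (AlgHom.id k A) val.val *
        (val.val ⊗ₜ[k] (1 : A))) =
    Algebra.TensorProduct.map (AlgHom.id k A) (Bialgebra.comulAlgHom k A) val.val *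
        ((1 : A) ⊗ₜ[k] val.val)
  counit_left :
    Algebra.TensorProduct.lid k A
      (Algebra.TensorProduct.map (Bialgebra.counitAlgHom k A) (AlgHom.id k A) val.val) = 1
  counit_right :
    Algebra.TensorProduct.rid k k A
      (Algebra.TensorProduct.map (AlgHom.id k A) (Bialgebra.counitAlgHom k A) val.val) = 1

namespace HopfTwist

variable {k A : Type*} [CommRing k] [Ring A] [Bialgebra k A]

/-- The twisted comultiplication `Δ^J(h) = J⁻¹ Δ(h) J`. -/
def comul (J : HopfTwist k A) : A →ₐ[k] A ⊗[k] A :=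
  AlgHom.ofLinearMap
    (LinearMap.mulLeft k (J.val⁻¹).val ∘ₗ LinearMap.mulRight k J.val.val ∘ₗ
      (Bialgebra.comulAlgHom k A).toLinearMap)
    (by simp)
    (fun x y => by simp [mul_assoc])

theorem comul_apply (J : HopfTwist k A) (h : A) :
    J.comul h = (J.val⁻¹).val * Coalgebra.comul h * J.val.val := by
  simp [comul, mul_assoc]

theorem map_comul_left (J : HopfTwist k A) (x : A ⊗[k] A) :
    Algebra.TensorProduct.map J.comul (AlgHom.id k A) x =
      ((J.val⁻¹).val ⊗ₜ[k] (1 : A)) *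
        Algebra.TensorProduct.map (Bialgebra.comulAlgHom k A) (AlgHom.id k A) x *
        (J.val.val ⊗ₜ[k] (1 : A)) := by
  induction x with
  | zero => simp
  | add x y hx hy => simp only [map_add, hx, hy, mul_add, add_mul]
  | tmul a b => simp [comul_apply]

theorem map_comul_right (J : HopfTwist k A) (x : A ⊗[k] A) :
    Algebra.TensorProduct.map (AlgHom.id k A) J.comul x =
      ((1 : A) ⊗ₜ[k] (J.val⁻¹).val) *
        Algebra.TensorProduct.map (AlgHom.id k A) (Bialgebra.comulAlgHom k A) x *
        ((1 : A) ⊗ₜ[k] J.val.val) := by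
  induction x with
  | zero => simp
  | add x y hx hy => simp only [map_add, hx, hy, mul_add, add_mul]
  | tmul a b => simp [comul_apply]

/-- The bialgebra `A^J`: the algebra `A` with the comultiplication `J⁻¹ Δ J` and the counit
of `A`. -/
abbrev bialgebra (J : HopfTwist k A) : Bialgebra k A :=
  Bialgebra.ofAlgHom J.comul (Bialgebra.counitAlgHom k A)
    (by
      ext h
      have e1 : Algebra.TensorProduct.map (Bialgebra.comulAlgHom k A) (AlgHom.id k A)
          (J.val⁻¹).val * Algebra.TensorProduct.map (Bialgebra.comulAlgHom k A) (AlgHom.id k A)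
          J.val.val = 1 := by rw [← map_mul]; simp
      have e2 : Algebra.TensorProduct.map (AlgHom.id k A) (Bialgebra.comulAlgHom k A)
          J.val.val * Algebra.TensorProduct.map (AlgHom.id k A) (Bialgebra.comulAlgHom k A)
          (J.val⁻¹).val = 1 := by rw [← map_mul]; simp
      have e3 : ((J.val⁻¹).val ⊗ₜ[k] (1 : A)) * (J.val.val ⊗ₜ[k] (1 : A)) = 1 := by
        simp [Algebra.TensorProduct.one_def]
      have e4 : ((1 : A) ⊗ₜ[k] J.val.val) * ((1 : A) ⊗ₜ[k] (J.val⁻¹).val) = 1 := by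
        simp [Algebra.TensorProduct.one_def]
      have hc := J.cocycle
      have hco : Algebra.TensorProduct.assoc k k k A A A
          (Algebra.TensorProduct.map (Bialgebra.comulAlgHom k A) (AlgHom.id k A)
            (Coalgebra.comul h)) =
          Algebra.TensorProduct.map (AlgHom.id k A) (Bialgebra.comulAlgHom k A)
            (Coalgebra.comul h) := Coalgebra.coassoc_apply h
      change Algebra.TensorProduct.assoc k k k A A A
          (Algebra.TensorProduct.map J.comul (AlgHom.id k A) (J.comul h)) =
        Algebra.TensorProduct.map (AlgHom.id k A) J.comul (J.comul h)
      have e5 : (J.val.val ⊗ₜ[k] (1 : A)) * ((J.val⁻¹).val ⊗ₜ[k] (1 : A)) = 1 := by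
        simp [Algebra.TensorProduct.one_def]
      simp only [map_comul_left, map_comul_right, comul_apply, map_mul] at hc hco ⊢
      have e1' := congrArg (Algebra.TensorProduct.assoc k k k A A A) e1
      have e3' := congrArg (Algebra.TensorProduct.assoc k k k A A A) e3
      have e5' := congrArg (Algebra.TensorProduct.assoc k k k A A A) e5
      simp only [map_mul, map_one] at e1' e3' e5'
      rw [hco]
      generalize Algebra.TensorProduct.assoc k k k A A A ((J.val⁻¹).val ⊗ₜ[k] (1 : A)) = a at *
      generalize Algebra.TensorProduct.assoc k k k A A A (J.val.val ⊗ₜ[k] (1 : A)) = b at *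
      generalize Algebra.TensorProduct.assoc k k k A A A
        (Algebra.TensorProduct.map (Bialgebra.comulAlgHom k A) (AlgHom.id k A) J.val.val) = c at *
      generalize Algebra.TensorProduct.assoc k k k A A A
        (Algebra.TensorProduct.map (Bialgebra.comulAlgHom k A) (AlgHom.id k A)
          (J.val⁻¹).val) = c' at *
      generalize Algebra.TensorProduct.map (AlgHom.id k A) (Bialgebra.comulAlgHom k A)
          J.val.val = d at *
      generalize Algebra.TensorProduct.map (AlgHom.id k A) (Bialgebra.comulAlgHom k A)
          (J.val⁻¹).val = d' at *
      generalize ((1 : A) ⊗ₜ[k] J.val.val) = f at *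
      generalize ((1 : A) ⊗ₜ[k] (J.val⁻¹).val) = f' at *
      have key : a * c' = f' * d' := by
        calc a * c' = a * c' * (d * (f * f') * d') := by rw [e4, mul_one, e2, mul_one]
          _ = a * c' * (d * f) * f' * d' := by simp only [mul_assoc]
          _ = a * (c' * c) * b * f' * d' := by rw [← hc]; simp only [mul_assoc]
          _ = f' * d' := by rw [e1', mul_one, e3', one_mul]
      generalize Algebra.TensorProduct.map (AlgHom.id k A) (Bialgebra.comulAlgHom k A)
        (Coalgebra.comul h) = x at *
      calc _ = (a * c') * (b * a) * x * (b * a) * (c * b) := by simp only [mul_assoc]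
        _ = (f' * d') * (f * f') * x * (f * f') * (d * f) := by rw [key, hc, e5', e4]
        _ = _ := by simp only [mul_assoc])
    (by
      ext h
      have hl := J.counit_left
      have hr : Algebra.TensorProduct.map (Bialgebra.counitAlgHom k A) (AlgHom.id k A)
          (Coalgebra.comul h) = 1 ⊗ₜ[k] h := Coalgebra.rTensor_counit_comul h
      have hJ : Algebra.TensorProduct.map (Bialgebra.counitAlgHom k A) (AlgHom.id k A)
          J.val.val = 1 := by
        apply (Algebra.TensorProduct.lid k A).injective; rw [hl, map_one]
      have hJ' : Algebra.TensorProduct.map (Bialgebra.counitAlgHom k A) (AlgHom.id k A)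
          (J.val⁻¹).val = 1 := by
        have : Algebra.TensorProduct.map (Bialgebra.counitAlgHom k A) (AlgHom.id k A)
          ((J.val⁻¹).val * J.val.val) = 1 := by simp
        rwa [map_mul, hJ, mul_one] at this
      simp [comul_apply, hr, hJ, hJ'])
    (by
      ext h
      have hl := J.counit_right
      have hr : Algebra.TensorProduct.map (AlgHom.id k A) (Bialgebra.counitAlgHom k A)
          (Coalgebra.comul h) = h ⊗ₜ[k] 1 := Coalgebra.lTensor_counit_comul h
      have hJ : Algebra.TensorProduct.map (AlgHom.id k A) (Bialgebra.counitAlgHom k A)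
          J.val.val = 1 := by
        apply (Algebra.TensorProduct.rid k k A).injective; rw [hl, map_one]
      have hJ' : Algebra.TensorProduct.map (AlgHom.id k A) (Bialgebra.counitAlgHom k A)
          (J.val⁻¹).val = 1 := by
        have : Algebra.TensorProduct.map (AlgHom.id k A) (Bialgebra.counitAlgHom k A)
          ((J.val⁻¹).val * J.val.val) = 1 := by simp
        rwa [map_mul, hJ, mul_one] at this
      simp [comul_apply, hr, hJ, hJ'])

/-- The underlying type of `A^J`. -/
def Twisted (_J : HopfTwist k A) : Type _ := A

instance (J : HopfTwist k A) : Ring J.Twisted := inferInstanceAs (Ring A)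

section Antipode

variable {H : Type*} [Ring H] [HopfAlgebra k H]

open HopfAlgebra

/-- The linear map `a ⊗ b ↦ S(a) b`. -/
def antipodeMul : H ⊗[k] H →ₗ[k] H := LinearMap.mul' k H ∘ₗ (antipode k).rTensor H

/-- The linear map `a ⊗ b ↦ a S(b)`. -/
def mulAntipode : H ⊗[k] H →ₗ[k] H := LinearMap.mul' k H ∘ₗ (antipode k).lTensor H

@[simp] theorem antipodeMul_tmul (a b : H) :
    antipodeMul (k := k) (a ⊗ₜ[k] b) = antipode k a * b := by simp [antipodeMul]

@[simp] theorem mulAntipode_tmul (a b : H) :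
    mulAntipode (k := k) (a ⊗ₜ[k] b) = a * antipode k b := by simp [mulAntipode]

theorem antipodeMul_comul (a : H) :
    antipodeMul (k := k) (Coalgebra.comul a) = algebraMap k H (Coalgebra.counit a) :=
  mul_antipode_rTensor_comul_apply a

theorem mulAntipode_comul (a : H) :
    mulAntipode (k := k) (Coalgebra.comul a) = algebraMap k H (Coalgebra.counit a) :=
  mul_antipode_lTensor_comul_apply a

theorem antipodeMul_mul_tmul (x : H ⊗[k] H) (c d : H) :
    antipodeMul (x * (c ⊗ₜ[k] d)) = antipode k c * antipodeMul x * d := by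
  induction x with
  | zero => simp
  | add x y hx hy => simp only [add_mul, map_add, hx, hy, mul_add]
  | tmul a b => simp [antipode_mul_antidistrib, mul_assoc]

theorem mulAntipode_tmul_mul (x : H ⊗[k] H) (c d : H) :
    mulAntipode ((c ⊗ₜ[k] d) * x) = c * mulAntipode x * antipode k d := by
  induction x with
  | zero => simp
  | add x y hx hy => simp only [add_mul, map_add, hx, hy, mul_add]
  | tmul a b => simp [antipode_mul_antidistrib, mul_assoc]

theorem antipodeMul_comul_mul (h : H) (x : H ⊗[k] H) :
    antipodeMul (Coalgebra.comul h * x) = (Coalgebra.counit h : k) • antipodeMul x := by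
  induction x with
  | zero => simp
  | add x y hx hy => simp only [map_add, hx, hy, mul_add, smul_add]
  | tmul a b =>
    rw [antipodeMul_mul_tmul, antipodeMul_comul, Algebra.algebraMap_eq_smul_one]; simp

theorem mulAntipode_mul_comul (h : H) (x : H ⊗[k] H) :
    mulAntipode (x * Coalgebra.comul h) = (Coalgebra.counit h : k) • mulAntipode x := by
  induction x with
  | zero => simp
  | add x y hx hy => simp only [map_add, hx, hy, add_mul, smul_add]
  | tmul a b =>
    rw [mulAntipode_tmul_mul, mulAntipode_comul, Algebra.algebraMap_eq_smul_one]; simp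

variable (J : HopfTwist k H)

/-- The element `v = m (S ⊗ id)(J)`. -/
def antipodeElem : H := antipodeMul J.val.val

/-- The element `m (id ⊗ S)(J⁻¹)`, inverse to `v`. -/
def antipodeElemInv : H := mulAntipode (J.val⁻¹).val

/-- The linear map `a ⊗ (b ⊗ c) ↦ S(a) b S(c)`. -/
def triple₁ : H ⊗[k] (H ⊗[k] H) →ₗ[k] H :=
  LinearMap.mul' k H ∘ₗ TensorProduct.map (antipode k) mulAntipode

/-- The linear map `a ⊗ (b ⊗ c) ↦ a S(b) c`. -/
def triple₂ : H ⊗[k] (H ⊗[k] H) →ₗ[k] H :=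
  LinearMap.mul' k H ∘ₗ TensorProduct.map LinearMap.id antipodeMul

theorem triple₁_aux (p q : H ⊗[k] H) (b c : H) :
    triple₁ (Algebra.TensorProduct.assoc k k k H H H (p ⊗ₜ[k] b) * (c ⊗ₜ[k] q)) =
      antipode k c * antipodeMul p * mulAntipode q * antipode k b := by
  induction p with
  | zero => simp
  | add x y hx hy =>
    simp only [TensorProduct.add_tmul, map_add, add_mul, hx, hy, mul_add]
  | tmul p₁ p₂ =>
    induction q with
    | zero => simp
    | add x y hx hy => simp only [TensorProduct.tmul_add, map_add, add_mul, hx, hy, mul_add]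
    | tmul q₁ q₂ => simp [triple₁, antipode_mul_antidistrib, mul_assoc]

theorem triple₂_aux (p q : H ⊗[k] H) (b c : H) :
    triple₂ ((b ⊗ₜ[k] p) * Algebra.TensorProduct.assoc k k k H H H (q ⊗ₜ[k] c)) =
      b * mulAntipode q * antipodeMul p * c := by
  induction p with
  | zero => simp
  | add x y hx hy =>
    simp only [TensorProduct.tmul_add, map_add, add_mul, hx, hy, mul_add]
  | tmul p₁ p₂ =>
    induction q with
    | zero => simp
    | add x y hx hy => simp only [TensorProduct.add_tmul, map_add, add_mul, hx, hy, mul_add]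
    | tmul q₁ q₂ => simp [triple₂, antipode_mul_antidistrib, mul_assoc]

theorem triple₁_map (x y : H ⊗[k] H) :
    triple₁ (Algebra.TensorProduct.assoc k k k H H H
        (Algebra.TensorProduct.map (Bialgebra.comulAlgHom k H) (AlgHom.id k H) x) *
        Algebra.TensorProduct.map (AlgHom.id k H) (Bialgebra.comulAlgHom k H) y) =
      antipode k (Algebra.TensorProduct.rid k k H
        (Algebra.TensorProduct.map (AlgHom.id k H) (Bialgebra.counitAlgHom k H) y)) *
      antipode k (Algebra.TensorProduct.lid k H
        (Algebra.TensorProduct.map (Bialgebra.counitAlgHom k H) (AlgHom.id k H) x)) := by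
  induction x with
  | zero => simp
  | add x y hx hy => simp only [map_add, add_mul, hx, hy, mul_add]
  | tmul a b =>
    induction y with
    | zero => simp
    | add x y hx hy => simp only [map_add, add_mul, hx, hy, mul_add]
    | tmul c d =>
      simp only [Algebra.TensorProduct.map_tmul, AlgHom.id_apply, Bialgebra.comulAlgHom_apply,
        triple₁_aux, antipodeMul_comul, mulAntipode_comul, Algebra.algebraMap_eq_smul_one]
      simp [smul_smul, mul_comm]

theorem triple₂_map (x y : H ⊗[k] H) :
    triple₂ (Algebra.TensorProduct.map (AlgHom.id k H) (Bialgebra.comulAlgHom k H) x *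
        Algebra.TensorProduct.assoc k k k H H H
        (Algebra.TensorProduct.map (Bialgebra.comulAlgHom k H) (AlgHom.id k H) y)) =
      Algebra.TensorProduct.rid k k H
        (Algebra.TensorProduct.map (AlgHom.id k H) (Bialgebra.counitAlgHom k H) x) *
      Algebra.TensorProduct.lid k H
        (Algebra.TensorProduct.map (Bialgebra.counitAlgHom k H) (AlgHom.id k H) y) := by
  induction x with
  | zero => simp
  | add x y hx hy => simp only [map_add, add_mul, hx, hy]
  | tmul a b =>
    induction y with
    | zero => simp
    | add x y hx hy => simp only [map_add, hx, hy, mul_add]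
    | tmul c d =>
      simp only [Algebra.TensorProduct.map_tmul, AlgHom.id_apply, Bialgebra.comulAlgHom_apply,
        triple₂_aux, antipodeMul_comul, mulAntipode_comul, Algebra.algebraMap_eq_smul_one]
      simp [smul_smul, mul_comm]

theorem counit_left_inv : Algebra.TensorProduct.lid k H
    (Algebra.TensorProduct.map (Bialgebra.counitAlgHom k H) (AlgHom.id k H)
      (J.val⁻¹).val) = 1 := by
  have : Algebra.TensorProduct.lid k H (Algebra.TensorProduct.map (Bialgebra.counitAlgHom k H)
    (AlgHom.id k H) ((J.val⁻¹).val * J.val.val)) = 1 := by rw [Units.inv_mul, map_one, map_one]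
  rwa [map_mul, map_mul, J.counit_left, mul_one] at this

theorem counit_right_inv : Algebra.TensorProduct.rid k k H
    (Algebra.TensorProduct.map (AlgHom.id k H) (Bialgebra.counitAlgHom k H)
      (J.val⁻¹).val) = 1 := by
  have : Algebra.TensorProduct.rid k k H (Algebra.TensorProduct.map (AlgHom.id k H)
    (Bialgebra.counitAlgHom k H) ((J.val⁻¹).val * J.val.val)) = 1 := by
      rw [Units.inv_mul, map_one, map_one]
  rwa [map_mul, map_mul, J.counit_right, mul_one] at this

theorem antipodeElem_mul_inv : J.antipodeElem * J.antipodeElemInv = 1 := by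
  have h := triple₁_map (J.val⁻¹).val J.val.val
  rw [J.counit_right, J.counit_left_inv, antipode_one, mul_one] at h
  rw [← h]
  have e1 : Algebra.TensorProduct.assoc k k k H H H
      (Algebra.TensorProduct.map (Bialgebra.comulAlgHom k H) (AlgHom.id k H) (J.val⁻¹).val) *
      Algebra.TensorProduct.assoc k k k H H H
      (Algebra.TensorProduct.map (Bialgebra.comulAlgHom k H) (AlgHom.id k H) J.val.val) = 1 := by
    rw [← map_mul, ← map_mul, Units.inv_mul, map_one, map_one]
  have e2 : ((1 : H) ⊗ₜ[k] J.val.val) * ((1 : H) ⊗ₜ[k] (J.val⁻¹).val) = 1 := by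
    simp [Algebra.TensorProduct.one_def]
  have hc := J.cocycle
  rw [map_mul] at hc
  have key : Algebra.TensorProduct.assoc k k k H H H
        (Algebra.TensorProduct.map (Bialgebra.comulAlgHom k H) (AlgHom.id k H) (J.val⁻¹).val) *
        Algebra.TensorProduct.map (AlgHom.id k H) (Bialgebra.comulAlgHom k H) J.val.val =
      Algebra.TensorProduct.assoc k k k H H H (J.val.val ⊗ₜ[k] (1 : H)) *
        ((1 : H) ⊗ₜ[k] (J.val⁻¹).val) := by
    rw [← mul_one (_ * Algebra.TensorProduct.map (AlgHom.id k H) _ _), ← e2, ← mul_assoc,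
      mul_assoc (Algebra.TensorProduct.assoc k k k H H H _), ← hc, ← mul_assoc, e1, one_mul]
  rw [key, triple₁_aux]
  simp [antipodeElem, antipodeElemInv]

theorem antipodeElemInv_mul : J.antipodeElemInv * J.antipodeElem = 1 := by
  have h := triple₂_map (J.val⁻¹).val J.val.val
  rw [J.counit_left, J.counit_right_inv, mul_one] at h
  rw [← h]
  have e1 : Algebra.TensorProduct.map (AlgHom.id k H) (Bialgebra.comulAlgHom k H)
      (J.val⁻¹).val *
      Algebra.TensorProduct.map (AlgHom.id k H) (Bialgebra.comulAlgHom k H) J.val.val = 1 := by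
    rw [← map_mul, Units.inv_mul, map_one]
  have e2 : Algebra.TensorProduct.assoc k k k H H H (J.val.val ⊗ₜ[k] (1 : H)) *
      Algebra.TensorProduct.assoc k k k H H H ((J.val⁻¹).val ⊗ₜ[k] (1 : H)) = 1 := by
    rw [← map_mul]; simp [← Algebra.TensorProduct.one_def]
  have hc := J.cocycle
  rw [map_mul] at hc
  have key : Algebra.TensorProduct.map (AlgHom.id k H) (Bialgebra.comulAlgHom k H)
        (J.val⁻¹).val * Algebra.TensorProduct.assoc k k k H H H
        (Algebra.TensorProduct.map (Bialgebra.comulAlgHom k H) (AlgHom.id k H) J.val.val) =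
      ((1 : H) ⊗ₜ[k] J.val.val) *
        Algebra.TensorProduct.assoc k k k H H H ((J.val⁻¹).val ⊗ₜ[k] (1 : H)) := by
    rw [← mul_one (_ * Algebra.TensorProduct.assoc k k k H H H _), ← e2, ← mul_assoc,
      mul_assoc (Algebra.TensorProduct.map (AlgHom.id k H) _ _), hc, ← mul_assoc, e1, one_mul]
  rw [key, triple₂_aux]
  simp [antipodeElem, antipodeElemInv]

/-- The twisted antipode `S^J(h) = v⁻¹ S(h) v`. -/
def twistedAntipode : H →ₗ[k] H :=
  LinearMap.mulLeft k J.antipodeElemInv ∘ₗ LinearMap.mulRight k J.antipodeElem ∘ₗ antipode k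

theorem twistedAntipode_left (x : H ⊗[k] H) :
    LinearMap.mul' k H (J.twistedAntipode.rTensor H x) =
      J.antipodeElemInv * antipodeMul (J.val.val * x) := by
  induction x with
  | zero => simp
  | add x y hx hy => simp only [map_add, hx, hy, mul_add]
  | tmul a b => rw [antipodeMul_mul_tmul]; simp [twistedAntipode, antipodeElem, mul_assoc]

theorem twistedAntipode_right (x : H ⊗[k] H) :
    LinearMap.mul' k H (J.twistedAntipode.lTensor H x) =
      mulAntipode (x * (J.val⁻¹).val) * J.antipodeElem := by
  induction x with
  | zero => simp
  | add x y hx hy => simp only [map_add, hx, hy, add_mul]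
  | tmul a b => rw [mulAntipode_tmul_mul]; simp [twistedAntipode, antipodeElemInv, mul_assoc]

/-- The Hopf algebra `A^J`. -/
abbrev hopfAlgebra : HopfAlgebra k H :=
  { J.bialgebra with
    antipode := J.twistedAntipode
    mul_antipode_rTensor_comul := by
      ext h
      refine (J.twistedAntipode_left (J.comul h)).trans ?_
      rw [comul_apply, ← mul_assoc, ← mul_assoc, Units.mul_inv, one_mul, antipodeMul_comul_mul,
        mul_smul_comm]
      change _ • (J.antipodeElemInv * J.antipodeElem) = _
      rw [antipodeElemInv_mul]
      exact (Algebra.algebraMap_eq_smul_one _).symm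
    mul_antipode_lTensor_comul := by
      ext h
      refine (J.twistedAntipode_right (J.comul h)).trans ?_
      rw [comul_apply, mul_assoc, Units.mul_inv, mul_one, mulAntipode_mul_comul,
        smul_mul_assoc]
      change _ • (J.antipodeElemInv * J.antipodeElem) = _
      rw [antipodeElemInv_mul]
      exact (Algebra.algebraMap_eq_smul_one _).symm }

instance : HopfAlgebra k J.Twisted := J.hopfAlgebra

instance [Module.Finite k H] : Module.Finite k J.Twisted :=
  inferInstanceAs (Module.Finite k H)

end Antipode

end HopfTwist

/-! ### The dual of a finite-dimensional Hopf algebra -/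

/-- The dual `A* = Hom_k(A, k)` of a Hopf algebra, a `k`-algebra under the convolution product
`(f * g)(a) = ∑ f(a₁) g(a₂)` with unit `ε`. -/
def HopfDual (k A : Type*) [Field k] [Ring A] [HopfAlgebra k A] : Type _ :=
  WithConv (A →ₗ[k] k)

namespace HopfDual

section Basic

variable {k A : Type*} [Field k] [Ring A] [HopfAlgebra k A]

instance : Ring (HopfDual k A) := inferInstanceAs (Ring (WithConv (A →ₗ[k] k)))

instance : Algebra k (HopfDual k A) := inferInstanceAs (Algebra k (WithConv (A →ₗ[k] k)))

variable (k A) in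
/-- The identification of `A*` with the vector space of linear forms on `A`. -/
def toDual : HopfDual k A ≃ₗ[k] Module.Dual k A where
  toFun f := WithConv.ofConv (A := A →ₗ[k] k) f
  invFun f := WithConv.toConv (A := A →ₗ[k] k) f
  map_add' _ _ := rfl
  map_smul' _ _ := rfl
  left_inv _ := rfl
  right_inv _ := rfl

theorem ext {f g : HopfDual k A} (h : ∀ a, toDual k A f a = toDual k A g a) : f = g :=
  (toDual k A).injective (LinearMap.ext h)

theorem mul_apply (f g : HopfDual k A) (a : A) :
    toDual k A (f * g) a =
      LinearMap.mul' k k (TensorProduct.map (toDual k A f) (toDual k A g)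
        (Coalgebra.comul a)) := rfl

theorem one_apply (a : A) : toDual k A 1 a = Coalgebra.counit a := rfl

theorem algebraMap_apply (c : k) (a : A) :
    toDual k A (algebraMap k (HopfDual k A) c) a = c * Coalgebra.counit a := rfl

variable (k A) in
/-- The counit of `A*`, the evaluation at `1`. -/
def counit : HopfDual k A →ₗ[k] k :=
  (LinearMap.applyₗ (1 : A)) ∘ₗ (toDual k A).toLinearMap

@[simp] theorem counit_apply (f : HopfDual k A) : counit k A f = toDual k A f 1 := rfl

variable (k A) in
/-- The antipode of `A*`, the transpose of the antipode of `A`. -/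
def antipode : HopfDual k A →ₗ[k] HopfDual k A :=
  (toDual k A).symm.toLinearMap ∘ₗ (HopfAlgebra.antipode k (A := A)).dualMap ∘ₗ
    (toDual k A).toLinearMap

@[simp] theorem antipode_apply (f : HopfDual k A) (a : A) :
    toDual k A (antipode k A f) a = toDual k A f (HopfAlgebra.antipode k a) := rfl

end Basic

variable {k A : Type*} [Field k] [Ring A] [HopfAlgebra k A] [Module.Finite k A]

variable (k A) in
/-- The isomorphism `A* ⊗ A* ≃ (A ⊗ A)*`, `f ⊗ g ↦ (a ⊗ b ↦ f(a) g(b))`. -/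
def pairing : HopfDual k A ⊗[k] HopfDual k A ≃ₗ[k] Module.Dual k (A ⊗[k] A) :=
  (TensorProduct.congr (toDual k A)
    (toDual k A)).trans (TensorProduct.dualDistribEquiv k A A)

@[simp] theorem pairing_tmul (f g : HopfDual k A) (a b : A) :
    pairing k A (f ⊗ₜ[k] g) (a ⊗ₜ[k] b) = toDual k A f a * toDual k A g b := rfl

variable (k A) in
/-- The comultiplication of `A*`, the transpose of the multiplication of `A`. -/
def comul : HopfDual k A →ₗ[k] HopfDual k A ⊗[k] HopfDual k A :=
  (pairing k A).symm.toLinearMap ∘ₗ (LinearMap.mul' k A).dualMap ∘ₗ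
    (toDual k A).toLinearMap

theorem pairing_comul (f : HopfDual k A) (x : A ⊗[k] A) :
    pairing k A (comul k A f) x = toDual k A f (LinearMap.mul' k A x) := by
  simp [comul]

theorem pairing_ext {x y : HopfDual k A ⊗[k] HopfDual k A}
    (h : ∀ a b, pairing k A x (a ⊗ₜ[k] b) = pairing k A y (a ⊗ₜ[k] b)) : x = y := by
  apply (pairing k A).injective
  ext a b
  exact h a b

variable (k A) in
/-- The isomorphism `A* ⊗ (A* ⊗ A*) ≃ (A ⊗ (A ⊗ A))*`. -/
def pairing₃ : HopfDual k A ⊗[k] (HopfDual k A ⊗[k] HopfDual k A) ≃ₗ[k]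
    Module.Dual k (A ⊗[k] (A ⊗[k] A)) :=
  (TensorProduct.congr (toDual k A) (pairing k A)).trans
    (TensorProduct.dualDistribEquiv k A (A ⊗[k] A))

theorem pairing₃_tmul (f : HopfDual k A) (y : HopfDual k A ⊗[k] HopfDual k A) (a : A)
    (z : A ⊗[k] A) : pairing₃ k A (f ⊗ₜ[k] y) (a ⊗ₜ[k] z) = toDual k A f a * pairing k A y z := rfl

theorem pairing₃_assoc (y : HopfDual k A ⊗[k] HopfDual k A) (g : HopfDual k A) (a b c : A) :
    pairing₃ k A (TensorProduct.assoc k _ _ _ (y ⊗ₜ[k] g)) (a ⊗ₜ[k] (b ⊗ₜ[k] c)) =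
      pairing k A y (a ⊗ₜ[k] b) * toDual k A g c := by
  induction y with
  | zero => simp
  | add x y hx hy => simp only [TensorProduct.add_tmul, map_add, LinearMap.add_apply, hx, hy, add_mul]
  | tmul f h => simp [pairing₃_tmul, mul_assoc]

instance : Coalgebra k (HopfDual k A) where
  comul := comul k A
  counit := counit k A
  coassoc := by
    have h1 (x : HopfDual k A ⊗[k] HopfDual k A) (a b c : A) :
        pairing₃ k A (TensorProduct.assoc k _ _ _ ((comul k A).rTensor _ x))
          (a ⊗ₜ[k] (b ⊗ₜ[k] c)) = pairing k A x ((a * b) ⊗ₜ[k] c) := by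
      induction x with
      | zero => simp
      | add x y hx hy => simp only [map_add, LinearMap.add_apply, hx, hy]
      | tmul f g =>
        rw [LinearMap.rTensor_tmul, pairing₃_assoc, pairing_comul]; simp
    have h2 (x : HopfDual k A ⊗[k] HopfDual k A) (a b c : A) :
        pairing₃ k A ((comul k A).lTensor _ x)
          (a ⊗ₜ[k] (b ⊗ₜ[k] c)) = pairing k A x (a ⊗ₜ[k] (b * c)) := by
      induction x with
      | zero => simp
      | add x y hx hy => simp only [map_add, LinearMap.add_apply, hx, hy]
      | tmul f g =>
        rw [LinearMap.lTensor_tmul, pairing₃_tmul, pairing_comul]; simp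
    apply LinearMap.ext
    intro f
    apply (pairing₃ k A).injective
    apply TensorProduct.ext
    apply LinearMap.ext
    intro a
    apply TensorProduct.ext'
    intro b c
    refine (h1 (comul k A f) a b c).trans ((?_ : _ = _).trans (h2 (comul k A f) a b c).symm)
    rw [pairing_comul, pairing_comul]
    simp [mul_assoc]
  rTensor_counit_comp_comul := by
    have h (x : HopfDual k A ⊗[k] HopfDual k A) (a : A) :
        toDual k A (TensorProduct.lid k _ ((counit k A).rTensor _ x)) a =
          pairing k A x (1 ⊗ₜ[k] a) := by
      induction x with
      | zero => simp
      | add x y hx hy => simp only [map_add, LinearMap.add_apply, hx, hy]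
      | tmul f g => simp
    ext1 f
    apply (TensorProduct.lid k (HopfDual k A)).injective
    apply HopfDual.ext
    intro a
    refine (h (comul k A f) a).trans ?_
    rw [pairing_comul]
    simp
  lTensor_counit_comp_comul := by
    have h (x : HopfDual k A ⊗[k] HopfDual k A) (a : A) :
        toDual k A (TensorProduct.rid k _ ((counit k A).lTensor _ x)) a =
          pairing k A x (a ⊗ₜ[k] 1) := by
      induction x with
      | zero => simp
      | add x y hx hy => simp only [map_add, LinearMap.add_apply, hx, hy]
      | tmul f g => simp [mul_comm]
    ext1 f
    apply (TensorProduct.rid k (HopfDual k A)).injective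
    apply HopfDual.ext
    intro a
    refine (h (comul k A f) a).trans ?_
    rw [pairing_comul]
    simp

theorem pairing_coalgebra_comul (f : HopfDual k A) (x : A ⊗[k] A) :
    pairing k A (Coalgebra.comul f) x = toDual k A f (LinearMap.mul' k A x) := pairing_comul f x

theorem pairing_mul (x y : HopfDual k A ⊗[k] HopfDual k A) (a b : A) :
    pairing k A (x * y) (a ⊗ₜ[k] b) =
      LinearMap.mul' k k (TensorProduct.map (pairing k A x) (pairing k A y)
        (TensorProduct.tensorTensorTensorComm k A A A A
          (Coalgebra.comul a ⊗ₜ[k] Coalgebra.comul b))) := by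
  induction x with
  | zero => simp
  | add x₁ x₂ h₁ h₂ =>
    simp only [add_mul, map_add, LinearMap.add_apply, h₁, h₂, TensorProduct.map_add_left]
  | tmul f g =>
    induction y with
    | zero => simp
    | add x₁ x₂ h₁ h₂ =>
      simp only [mul_add, map_add, LinearMap.add_apply, h₁, h₂, TensorProduct.map_add_right]
    | tmul f' g' =>
      have key (s t : A ⊗[k] A) :
          LinearMap.mul' k k (TensorProduct.map (toDual k A f) (toDual k A f') s) *
            LinearMap.mul' k k (TensorProduct.map (toDual k A g) (toDual k A g') t) =
          LinearMap.mul' k k (TensorProduct.map (pairing k A (f ⊗ₜ[k] g))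
            (pairing k A (f' ⊗ₜ[k] g'))
            (TensorProduct.tensorTensorTensorComm k A A A A (s ⊗ₜ[k] t))) := by
        induction s with
        | zero => simp
        | add x₁ x₂ h₁ h₂ => simp only [TensorProduct.add_tmul, map_add, add_mul, h₁, h₂]
        | tmul s₁ s₂ =>
          induction t with
          | zero => simp
          | add x₁ x₂ h₁ h₂ => simp only [TensorProduct.tmul_add, map_add, mul_add, h₁, h₂]
          | tmul t₁ t₂ => simp; ring
      rw [← key, Algebra.TensorProduct.tmul_mul_tmul, pairing_tmul, mul_apply, mul_apply]

instance : Bialgebra k (HopfDual k A) :=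
  Bialgebra.mk' k (HopfDual k A)
    (by
      change toDual k A (1 : HopfDual k A) 1 = 1
      simp [one_apply])
    (by
      intro f g
      change toDual k A (f * g) 1 = toDual k A f 1 * toDual k A g 1
      simp [mul_apply, Algebra.TensorProduct.one_def])
    (by
      apply pairing_ext
      intro a b
      rw [pairing_coalgebra_comul, Algebra.TensorProduct.one_def]
      simp [one_apply])
    (by
      intro f g
      apply pairing_ext
      intro a b
      have key (s t : A ⊗[k] A) :
          LinearMap.mul' k k (TensorProduct.map (pairing k A (Coalgebra.comul f))
            (pairing k A (Coalgebra.comul g))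
            (TensorProduct.tensorTensorTensorComm k A A A A (s ⊗ₜ[k] t))) =
          LinearMap.mul' k k (TensorProduct.map (toDual k A f) (toDual k A g) (s * t)) := by
        induction s with
        | zero => simp
        | add x₁ x₂ h₁ h₂ => simp only [TensorProduct.add_tmul, map_add, add_mul, h₁, h₂]
        | tmul s₁ s₂ =>
          induction t with
          | zero => simp
          | add x₁ x₂ h₁ h₂ => simp only [TensorProduct.tmul_add, map_add, mul_add, h₁, h₂]
          | tmul t₁ t₂ => simp [pairing_coalgebra_comul]
      rw [pairing_mul, key, pairing_coalgebra_comul, LinearMap.mul'_apply, ← Bialgebra.comul_mul]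
      rfl)

instance : HopfAlgebra k (HopfDual k A) where
  antipode := antipode k A
  mul_antipode_rTensor_comul := by
    have h (x : HopfDual k A ⊗[k] HopfDual k A) (a : A) :
        toDual k A (LinearMap.mul' k (HopfDual k A) ((antipode k A).rTensor _ x)) a =
          pairing k A x ((HopfAlgebra.antipode k).rTensor A (Coalgebra.comul a)) := by
      induction x with
      | zero => simp
      | add x y hx hy => simp only [map_add, LinearMap.add_apply, hx, hy]
      | tmul f g =>
        rw [LinearMap.rTensor_tmul, LinearMap.mul'_apply, mul_apply]
        induction (Coalgebra.comul a : A ⊗[k] A) with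
        | zero => simp
        | add x y hx hy => simp only [map_add, hx, hy]
        | tmul a b => simp
    ext1 f
    apply HopfDual.ext
    intro a
    refine (h (Coalgebra.comul f) a).trans ?_
    rw [pairing_coalgebra_comul, HopfAlgebra.mul_antipode_rTensor_comul_apply]
    change _ = toDual k A f 1 * _
    rw [Algebra.algebraMap_eq_smul_one, map_smul, smul_eq_mul, mul_comm]
    rfl
  mul_antipode_lTensor_comul := by
    have h (x : HopfDual k A ⊗[k] HopfDual k A) (a : A) :
        toDual k A (LinearMap.mul' k (HopfDual k A) ((antipode k A).lTensor _ x)) a =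
          pairing k A x ((HopfAlgebra.antipode k).lTensor A (Coalgebra.comul a)) := by
      induction x with
      | zero => simp
      | add x y hx hy => simp only [map_add, LinearMap.add_apply, hx, hy]
      | tmul f g =>
        rw [LinearMap.lTensor_tmul, LinearMap.mul'_apply, mul_apply]
        induction (Coalgebra.comul a : A ⊗[k] A) with
        | zero => simp
        | add x y hx hy => simp only [map_add, hx, hy]
        | tmul a b => simp
    ext1 f
    apply HopfDual.ext
    intro a
    refine (h (Coalgebra.comul f) a).trans ?_
    rw [pairing_coalgebra_comul, HopfAlgebra.mul_antipode_lTensor_comul_apply]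
    change _ = toDual k A f 1 * _
    rw [Algebra.algebraMap_eq_smul_one, map_smul, smul_eq_mul, mul_comm]
    rfl

end HopfDual

/-! ### The twist of a group algebra lifted from an abelian subgroup -/

/-- A normalized 2-cocycle on the group `Γ` with values in the trivial `Γ`-module `M`. -/
structure NormalizedTwoCocycle (Γ M : Type*) [Group Γ] [CommGroup M] where
  toFun : Γ → Γ → M
  cocycle : ∀ α β γ, toFun (α * β) γ * toFun α β = toFun α (β * γ) * toFun β γ
  one_left : ∀ β, toFun 1 β = 1
  one_right : ∀ α, toFun α 1 = 1

namespace NormalizedTwoCocycle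

variable {Γ M : Type*} [CommGroup Γ] [CommGroup M]

/-- An element `α` of the abelian group `Γ` is `ω`-regular if `ω(α, β) = ω(β, α)` for all `β`. -/
def IsRegular (ω : NormalizedTwoCocycle Γ M) (α : Γ) : Prop :=
  ∀ β, ω.toFun α β = ω.toFun β α

/-- A 2-cocycle on an abelian group is non-degenerate if `1` is the only regular element. -/
def IsNondegenerate (ω : NormalizedTwoCocycle Γ M) : Prop :=
  ∀ α, ω.IsRegular α → α = 1

end NormalizedTwoCocycle

namespace GroupTwist

section PairSum

variable {k A ι : Type*} [Field k] [Ring A]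

/-- The element `∑_{α, β} f(α, β) e_α ⊗ e_β` of `A ⊗ A`, for a finite family `e` in `A`. -/
def pairSum [Algebra k A] (e : ι → A) (f : ι → ι → k) : A ⊗[k] A :=
  ∑ᶠ α : ι, ∑ᶠ β : ι, f α β • (e α ⊗ₜ[k] e β)

section Algebra

variable [Algebra k A] [Fintype ι] {e : ι → A}

theorem pairSum_eq (e : ι → A) (f : ι → ι → k) :
    pairSum e f = ∑ α : ι, ∑ β : ι, f α β • (e α ⊗ₜ[k] e β) := by
  simp only [pairSum, finsum_eq_sum_of_fintype]

theorem pairSum_one (hs : ∑ α, e α = 1) : pairSum e (fun _ _ => (1 : k)) = 1 := by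
  simp only [pairSum_eq, one_smul]
  simp_rw [← TensorProduct.tmul_sum, ← TensorProduct.sum_tmul, hs]
  rfl

theorem eq_of_mul_tmul (hs : ∑ α, e α = 1) {x y : A ⊗[k] (A ⊗[k] A)}
    (h : ∀ α β γ, x * (e α ⊗ₜ[k] (e β ⊗ₜ[k] e γ)) =
      y * (e α ⊗ₜ[k] (e β ⊗ₜ[k] e γ))) : x = y := by
  have h1 : ∑ α : ι, ∑ β : ι, ∑ γ : ι, (e α ⊗ₜ[k] (e β ⊗ₜ[k] e γ)) = 1 := by
    simp only [← TensorProduct.tmul_sum, ← TensorProduct.sum_tmul, hs]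
    rfl
  rw [← mul_one x, ← mul_one y, ← h1]
  simp only [Finset.mul_sum, h]

variable [DecidableEq ι]

theorem pairSum_mul_tmul (he : ∀ α β, e α * e β = if α = β then e β else 0)
    (f : ι → ι → k) (α β : ι) :
    pairSum e f * (e α ⊗ₜ[k] e β) = f α β • (e α ⊗ₜ[k] e β) := by
  rw [pairSum_eq, Finset.sum_mul, Finset.sum_eq_single α]
  · rw [Finset.sum_mul, Finset.sum_eq_single β]
    · simp [he]
    · intro b _ hb
      simp [he, hb]
    · simp
  · intro b _ hb
    rw [Finset.sum_mul]
    simp [he, hb]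
  · simp

theorem pairSum_mul (he : ∀ α β, e α * e β = if α = β then e β else 0)
    (f g : ι → ι → k) :
    pairSum e f * pairSum e g = pairSum e (fun α β => f α β * g α β) := by
  rw [pairSum_eq e g, pairSum_eq e (fun α β => f α β * g α β)]
  simp only [Finset.mul_sum, mul_smul_comm, pairSum_mul_tmul he, smul_smul, mul_comm (f _ _)]

end Algebra

variable [Bialgebra k A] [Fintype ι] [DecidableEq ι] {e : ι → A} [CommGroup ι]

theorem map_comul_left_pairSum (he : ∀ α β, e α * e β = if α = β then e β else 0)
    (hΔ : ∀ α β γ, Coalgebra.comul (R := k) (e γ) * (e α ⊗ₜ[k] e β) =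
      if α * β = γ then e α ⊗ₜ[k] e β else 0) (f : ι → ι → k) (α β γ : ι) :
    Algebra.TensorProduct.map (Bialgebra.comulAlgHom k A) (AlgHom.id k A)
        (pairSum e f) * ((e α ⊗ₜ[k] e β) ⊗ₜ[k] e γ) =
      f (α * β) γ • ((e α ⊗ₜ[k] e β) ⊗ₜ[k] e γ) := by
  rw [pairSum_eq, map_sum, Finset.sum_mul, Finset.sum_eq_single (α * β)]
  · rw [map_sum, Finset.sum_mul, Finset.sum_eq_single γ]
    · simp [he, hΔ]
    · intro b _ hb
      simp [he, hb]
    · simp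
  · intro b _ hb
    rw [map_sum, Finset.sum_mul]
    simp [hΔ, Ne.symm hb]
  · simp

theorem map_comul_right_pairSum (he : ∀ α β, e α * e β = if α = β then e β else 0)
    (hΔ : ∀ α β γ, Coalgebra.comul (R := k) (e γ) * (e α ⊗ₜ[k] e β) =
      if α * β = γ then e α ⊗ₜ[k] e β else 0) (f : ι → ι → k) (α β γ : ι) :
    Algebra.TensorProduct.map (AlgHom.id k A) (Bialgebra.comulAlgHom k A)
        (pairSum e f) * (e α ⊗ₜ[k] (e β ⊗ₜ[k] e γ)) =
      f α (β * γ) • (e α ⊗ₜ[k] (e β ⊗ₜ[k] e γ)) := by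
  rw [pairSum_eq, map_sum, Finset.sum_mul, Finset.sum_eq_single α]
  · rw [map_sum, Finset.sum_mul, Finset.sum_eq_single (β * γ)]
    · simp [he, hΔ]
    · intro b _ hb
      simp [hΔ, Ne.symm hb]
    · simp
  · intro b _ hb
    rw [map_sum, Finset.sum_mul]
    simp [he, hb]
  · simp

theorem pairSum_cocycle (hs : ∑ α, e α = 1)
    (he : ∀ α β, e α * e β = if α = β then e β else 0)
    (hΔ : ∀ α β γ, Coalgebra.comul (R := k) (e γ) * (e α ⊗ₜ[k] e β) =
      if α * β = γ then e α ⊗ₜ[k] e β else 0) (f : ι → ι → k)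
    (hf : ∀ α β γ, f (α * β) γ * f α β = f α (β * γ) * f β γ) :
    Algebra.TensorProduct.assoc k k k A A A
      (Algebra.TensorProduct.map (Bialgebra.comulAlgHom k A) (AlgHom.id k A) (pairSum e f) *
        (pairSum e f ⊗ₜ[k] (1 : A))) =
    Algebra.TensorProduct.map (AlgHom.id k A) (Bialgebra.comulAlgHom k A) (pairSum e f) *
        ((1 : A) ⊗ₜ[k] pairSum e f) := by
  apply eq_of_mul_tmul hs
  intro α β γ
  have h : e α ⊗ₜ[k] (e β ⊗ₜ[k] e γ) =
    Algebra.TensorProduct.assoc k k k A A A ((e α ⊗ₜ[k] e β) ⊗ₜ[k] e γ) := rfl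
  conv_lhs => rw [h, ← map_mul, mul_assoc, Algebra.TensorProduct.tmul_mul_tmul,
    pairSum_mul_tmul he, one_mul, ← TensorProduct.smul_tmul', mul_smul_comm,
    map_comul_left_pairSum he hΔ, smul_smul, map_smul, ← h]
  rw [mul_assoc, Algebra.TensorProduct.tmul_mul_tmul,
    pairSum_mul_tmul he, one_mul, TensorProduct.tmul_smul, mul_smul_comm,
    map_comul_right_pairSum he hΔ, smul_smul]
  congr 1
  linear_combination hf α β γ

theorem pairSum_counit_left (hs : ∑ α, e α = 1)
    (hε : ∀ γ, Coalgebra.counit (R := k) (e γ) = if γ = 1 then 1 else 0) (f : ι → ι → k)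
    (hf : ∀ β, f 1 β = 1) :
    Algebra.TensorProduct.lid k A
      (Algebra.TensorProduct.map (Bialgebra.counitAlgHom k A) (AlgHom.id k A)
        (pairSum e f)) = 1 := by
  rw [pairSum_eq, ← hs, map_sum, map_sum, Finset.sum_eq_single 1]
  · simp [hε, hf]
  · intro b _ hb
    simp [hε, hb]
  · simp

theorem pairSum_counit_right (hs : ∑ α, e α = 1)
    (hε : ∀ γ, Coalgebra.counit (R := k) (e γ) = if γ = 1 then 1 else 0) (f : ι → ι → k)
    (hf : ∀ α, f α 1 = 1) :
    Algebra.TensorProduct.rid k k A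
      (Algebra.TensorProduct.map (AlgHom.id k A) (Bialgebra.counitAlgHom k A)
        (pairSum e f)) = 1 := by
  rw [pairSum_eq, ← hs, Finset.sum_comm, map_sum, map_sum, Finset.sum_eq_single 1]
  · simp [hε, hf]
  · intro b _ hb
    simp [hε, hb]
  · simp

end PairSum

variable {k G : Type*} [Field k] [Group G]

/-- The element `e_χ = |H|⁻¹ ∑_{h ∈ H} χ(h⁻¹) h` of the group algebra `k[G]`. -/
def charIdem (H : Subgroup G) (χ : H →* kˣ) : MonoidAlgebra k G :=
  (Nat.card H : k)⁻¹ • ∑ᶠ h : H, MonoidAlgebra.single (h : G) ((χ h⁻¹ : kˣ) : k)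

section Lemmas

variable [Finite G] [IsAlgClosed k] [CharZero k] (H : Subgroup G)

instance : Finite (H →* kˣ) := inferInstance

theorem charIdem_eq [Fintype H] (χ : H →* kˣ) :
    charIdem H χ = (Nat.card H : k)⁻¹ •
      ∑ h : H, ((χ h⁻¹ : kˣ) : k) • MonoidAlgebra.single (h : G) (1 : k) := by
  simp [charIdem, finsum_eq_sum_of_fintype]

theorem card_ne_zero : (Nat.card H : k) ≠ 0 := by
  exact_mod_cast Nat.card_pos.ne'

open Classical in
theorem sum_char [Fintype H] (χ : H →* kˣ) :
    ∑ h : H, ((χ h : kˣ) : k) = if χ = 1 then (Nat.card H : k) else 0 := by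
  have h := sum_hom_units ((Units.coeHom k).comp χ)
  have e : (Units.coeHom k).comp χ = 1 ↔ χ = 1 := by
    constructor
    · intro h
      ext x
      simpa using DFunLike.congr_fun h x
    · rintro rfl
      ext x
      simp
  rw [Nat.card_eq_fintype_card]
  simpa [e] using h

open Classical in
theorem sum_char_inv [Fintype H] (χ : H →* kˣ) :
    ∑ h : H, ((χ h⁻¹ : kˣ) : k) = if χ = 1 then (Nat.card H : k) else 0 := by
  rw [← sum_char H χ]
  exact Fintype.sum_equiv (Equiv.inv H) _ _ (fun x => rfl)

theorem single_mul_charIdem (h : H) (χ : H →* kˣ) :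
    MonoidAlgebra.single (h : G) (1 : k) * charIdem H χ = ((χ h : kˣ) : k) • charIdem H χ := by
  have := Fintype.ofFinite H
  rw [charIdem_eq]
  simp only [mul_smul_comm, Finset.mul_sum, Finset.smul_sum]
  refine Fintype.sum_equiv (Equiv.mulLeft h)
    (fun x : H => (Nat.card H : k)⁻¹ • ((χ x⁻¹ : kˣ) : k) •
      (MonoidAlgebra.single (h : G) (1 : k) * MonoidAlgebra.single (x : G) (1 : k)))
    (fun x : H => ((χ h : kˣ) : k) • (Nat.card H : k)⁻¹ • ((χ x⁻¹ : kˣ) : k) •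
      MonoidAlgebra.single (x : G) (1 : k)) (fun x => ?_)
  simp [MonoidAlgebra.single_mul_single]
  field_simp

theorem char_mul_inv_eq_one (α β : H →* kˣ) : α * β⁻¹ = 1 ↔ α = β := by
  constructor
  · intro h
    ext x
    have := DFunLike.congr_fun h x
    rw [MonoidHom.mul_apply, MonoidHom.inv_apply, MonoidHom.one_apply, mul_inv_eq_one] at this
    rw [this]
  · rintro rfl
    ext x
    simp

open Classical in
theorem charIdem_mul (α β : H →* kˣ) :
    charIdem H α * charIdem H β = if α = β then charIdem H β else 0 := by
  have := Fintype.ofFinite H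
  rw [charIdem_eq H α, smul_mul_assoc, Finset.sum_mul]
  have h1 (h : H) : ((α h⁻¹ : kˣ) : k) • MonoidAlgebra.single (h : G) (1 : k) * charIdem H β =
      (((α * β⁻¹) h⁻¹ : kˣ) : k) • charIdem H β := by
    rw [smul_mul_assoc, single_mul_charIdem, smul_smul]
    simp
  simp_rw [h1]
  rw [← Finset.sum_smul, sum_char_inv, smul_smul]
  simp only [char_mul_inv_eq_one]
  split_ifs with h
  · rw [inv_mul_cancel₀ (card_ne_zero H), one_smul]
  · simp

open Classical in
theorem comul_charIdem_mul (α β γ : H →* kˣ) :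
    Coalgebra.comul (R := k) (charIdem H γ) * (charIdem H α ⊗ₜ[k] charIdem H β) =
      if α * β = γ then charIdem H α ⊗ₜ[k] charIdem H β else 0 := by
  have := Fintype.ofFinite H
  rw [charIdem_eq H γ]
  simp only [map_smul, map_sum, MonoidAlgebra.comul_single, smul_mul_assoc, Finset.sum_mul]
  have h1 (h : H) : ((γ h⁻¹ : kˣ) : k) •
      (TensorProduct.map (MonoidAlgebra.lsingle (R := k) (h : G))
        (MonoidAlgebra.lsingle (R := k) (h : G)) (Coalgebra.comul (1 : k)) *
        (charIdem H α ⊗ₜ[k] charIdem H β)) =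
      (((γ * (α * β)⁻¹) h⁻¹ : kˣ) : k) • (charIdem H α ⊗ₜ[k] charIdem H β) := by
    simp only [CommSemiring.comul_apply, TensorProduct.map_tmul, MonoidAlgebra.lsingle_apply,
      Algebra.TensorProduct.tmul_mul_tmul, single_mul_charIdem, TensorProduct.smul_tmul_smul,
      smul_smul]
    congr 1
    simp
    ring
  simp_rw [h1]
  rw [← Finset.sum_smul, sum_char_inv, smul_smul]
  simp only [char_mul_inv_eq_one, @eq_comm _ γ]
  split_ifs with h
  · rw [inv_mul_cancel₀ (card_ne_zero H), one_smul]
  · simp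

open Classical in
theorem counit_charIdem (γ : H →* kˣ) :
    Coalgebra.counit (R := k) (charIdem H γ) = if γ = 1 then 1 else 0 := by
  have := Fintype.ofFinite H
  rw [charIdem_eq H γ]
  simp only [map_smul, map_sum, MonoidAlgebra.counit_single, CommSemiring.counit_apply,
    smul_eq_mul, mul_one, sum_char_inv]
  split_ifs with h
  · rw [inv_mul_cancel₀ (card_ne_zero H)]
  · simp

variable [IsMulCommutative H]

open Classical IsMulCommutative in
theorem sum_apply [Fintype (H →* kˣ)] (h : H) :
    ∑ χ : H →* kˣ, ((χ h : kˣ) : k) = if h = 1 then (Nat.card H : k) else 0 := by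
  split_ifs with hh
  · subst hh
    have : Nat.card (H →* kˣ) = Nat.card H :=
      CommGroup.card_monoidHom_of_hasEnoughRootsOfUnity H k
    simp [← this, Nat.card_eq_fintype_card]
  · obtain ⟨φ, hφ⟩ := CommGroup.exists_apply_ne_one_of_hasEnoughRootsOfUnity H k hh
    have e : ((φ h : kˣ) : k) * ∑ χ : H →* kˣ, ((χ h : kˣ) : k) =
        ∑ χ : H →* kˣ, ((χ h : kˣ) : k) := by
      rw [Finset.mul_sum]
      exact Fintype.sum_equiv (Equiv.mulLeft φ) _ _ (fun x => by simp)
    by_contra hne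
    apply hφ
    ext
    simpa using mul_right_cancel₀ hne (e.trans (one_mul _).symm)

theorem sum_charIdem [Fintype (H →* kˣ)] :
    ∑ χ : H →* kˣ, charIdem H χ = (1 : MonoidAlgebra k G) := by
  classical
  have := Fintype.ofFinite H
  simp_rw [charIdem_eq]
  rw [← Finset.smul_sum, Finset.sum_comm]
  simp_rw [← Finset.sum_smul, sum_apply]
  rw [Finset.sum_eq_single 1]
  · simp only [inv_one, if_true, smul_smul]
    rw [inv_mul_cancel₀ (card_ne_zero H), one_smul]
    rfl
  · intro b _ hb
    simp [hb]
  · simp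

end Lemmas

variable [Finite G] [IsAlgClosed k] [CharZero k] {H : Subgroup G} [IsMulCommutative H]

open Classical in
/-- The twist `J = ∑_{α, β ∈ Ĥ} ω(α, β) e_α ⊗ e_β` of `k[G]` lifted from the abelian subgroup `H`,
for a normalized 2-cocycle `ω` on the character group `Ĥ = Hom(H, kˣ)`. -/
def abelianTwist (ω : NormalizedTwoCocycle (H →* kˣ) kˣ) : HopfTwist k (MonoidAlgebra k G) :=
  letI := Fintype.ofFinite (H →* kˣ)
  { val :=
      { val := pairSum (charIdem H) (fun α β => (ω.toFun α β : k))
        inv := pairSum (charIdem H) (fun α β => ((ω.toFun α β)⁻¹ : kˣ))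
        val_inv := by
          rw [pairSum_mul (charIdem_mul H)]
          simpa using pairSum_one (sum_charIdem H)
        inv_val := by
          rw [pairSum_mul (charIdem_mul H)]
          simpa using pairSum_one (sum_charIdem H) }
    cocycle := pairSum_cocycle (sum_charIdem H) (charIdem_mul H) (comul_charIdem_mul H) _
      (fun α β γ => by exact_mod_cast congrArg Units.val (ω.cocycle α β γ))
    counit_left := pairSum_counit_left (sum_charIdem H) (counit_charIdem H) _
      (fun β => by simp [ω.one_left])
    counit_right := pairSum_counit_right (sum_charIdem H) (counit_charIdem H) _
      (fun β => by simp [ω.one_right]) }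

theorem abelianTwist_val (ω : NormalizedTwoCocycle (H →* kˣ) kˣ) :
    (abelianTwist ω).val.val = pairSum (charIdem H) (fun α β => (ω.toFun α β : k)) := rfl

end GroupTwist

/-! ### Central group-like elements and the index of a Hopf subalgebra -/

/-- The set `G(B) ∩ Z(B)` of central group-like elements of a Hopf algebra `B`. -/
def centralGroupLikes (k B : Type*) [Field k] [Ring B] [HopfAlgebra k B] : Set B :=
  {x | IsGroupLikeElem k x} ∩ Set.center B

/-- The group algebra of `G(B) ∩ Z(B)`, as the Hopf subalgebra of `B` spanned by this group. -/
def centralGroupLikeSpan (k B : Type*) [Field k] [Ring B] [HopfAlgebra k B] : Submodule k B :=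
  Submodule.span k (centralGroupLikes k B)

end

/-! A group-like element of $A^*$ is an algebra map $kG \to k$, that is, a linear character $\chi$
of $G$; twisting changes only the product of $A^*$, hence only which $\chi$ are central. Applying
$\chi$ to one tensor leg of $J$ leaves $L = \sum_\beta \omega(\xi,\beta) e_\beta$ or $R = \sum_\beta
\omega(\beta,\xi) e_\beta$, where $\xi = \chi|_H$, and $\chi$ is central in $A^*$ exactly when
$L^{-1} g L = R^{-1} g R$ for all $g \in G$, i.e. when $R L^{-1}$ is central in $kG$.

The coefficients $\omega(\beta,\xi)/\omega(\xi,\beta)$ of $R L^{-1}$ form a character of $\widehat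
H$ (`alternator`), so by duality they are evaluation at some $h \in H$, and Fourier inversion gives
$R L^{-1} = h$. As $Z(G) = 1$, centrality forces $h = 1$, so $\xi$ is regular, and $\xi = 1$ by
non-degeneracy. Conversely, $\xi = 1$ gives $L = R = 1$. This is `slices_comul_eq_iff`.

So $G(A^*) \cap Z(A^*)$ consists of the characters of $G$ trivial on $H$. There are $[G : H G']$ of
them (`card_monoidHom_le_ker`), and the index in question is $|H G'|$, a multiple of $|H|$. -/

namespace HopfDual

/-! ### Central group-like elements of a dual Hopf algebra as characters -/

section Slices

variable {k A : Type*} [CommRing k] [Ring A] [Algebra k A]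

/-- The slice map `φ ⊗ id : A ⊗ A → A` of a character `φ` of `A`. -/
noncomputable def leftSlice (φ : A →ₐ[k] k) : A ⊗[k] A →ₐ[k] A :=
  (Algebra.TensorProduct.lid k A).toAlgHom.comp (Algebra.TensorProduct.map φ (AlgHom.id k A))

/-- The slice map `id ⊗ φ : A ⊗ A → A` of a character `φ` of `A`. -/
noncomputable def rightSlice (φ : A →ₐ[k] k) : A ⊗[k] A →ₐ[k] A :=
  (Algebra.TensorProduct.rid k k A).toAlgHom.comp (Algebra.TensorProduct.map (AlgHom.id k A) φ)

@[simp] theorem leftSlice_tmul (φ : A →ₐ[k] k) (a b : A) :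
    leftSlice φ (a ⊗ₜ[k] b) = φ a • b := by simp [leftSlice]

@[simp] theorem rightSlice_tmul (φ : A →ₐ[k] k) (a b : A) :
    rightSlice φ (a ⊗ₜ[k] b) = φ b • a := by simp [rightSlice]

end Slices

variable {k A : Type*} [Field k] [Ring A] [HopfAlgebra k A]

/-- A character of `A`, as an element of the dual of `A`. -/
noncomputable def ofAlgHom (φ : A →ₐ[k] k) : HopfDual k A := (toDual k A).symm φ.toLinearMap

@[simp] theorem toDual_ofAlgHom (φ : A →ₐ[k] k) (a : A) :
    toDual k A (ofAlgHom φ) a = φ a := rfl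

theorem ofAlgHom_injective : Function.Injective (ofAlgHom : (A →ₐ[k] k) → HopfDual k A) :=
  fun φ ψ h => AlgHom.ext fun a => by rw [← toDual_ofAlgHom, h, toDual_ofAlgHom]

/-- Convolution by a character is the transpose of a slice of the comultiplication; this turns
centrality in the dual into an identity inside `A`. -/
theorem ofAlgHom_mul_apply (φ : A →ₐ[k] k) (g : HopfDual k A) (a : A) :
    toDual k A (ofAlgHom φ * g) a = toDual k A g (leftSlice φ (Coalgebra.comul a)) := by
  rw [mul_apply]
  induction (Coalgebra.comul a : A ⊗[k] A) with
  | zero => simp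
  | add x y hx hy => simp only [map_add, hx, hy]
  | tmul a b => simp

theorem mul_ofAlgHom_apply (φ : A →ₐ[k] k) (g : HopfDual k A) (a : A) :
    toDual k A (g * ofAlgHom φ) a = toDual k A g (rightSlice φ (Coalgebra.comul a)) := by
  rw [mul_apply]
  induction (Coalgebra.comul a : A ⊗[k] A) with
  | zero => simp
  | add x y hx hy => simp only [map_add, hx, hy]
  | tmul a b => simp [mul_comm]

/-- Left and right convolution by `φ` are transposes of the two sliced comultiplications, and linear
forms separate the points of `A`. -/
theorem ofAlgHom_mem_center_iff (φ : A →ₐ[k] k) :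
    ofAlgHom φ ∈ Set.center (HopfDual k A) ↔
      ∀ a : A, leftSlice φ (Coalgebra.comul a) = rightSlice φ (Coalgebra.comul a) := by
  rw [Semigroup.mem_center_iff]
  constructor
  · intro h a
    rw [← sub_eq_zero, ← Module.forall_dual_apply_eq_zero_iff k]
    intro g
    have hg := h ((toDual k A).symm g)
    have := congrArg (fun x => toDual k A x a) hg
    simp only [ofAlgHom_mul_apply, mul_ofAlgHom_apply, LinearEquiv.apply_symm_apply] at this
    rw [map_sub, this, sub_self]
  · intro h g
    apply HopfDual.ext
    intro a
    rw [ofAlgHom_mul_apply, mul_ofAlgHom_apply, h]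

variable (k A) in
theorem finrank_eq : Module.finrank k (HopfDual k A) = Module.finrank k A :=
  (toDual k A).finrank_eq.trans Subspace.dual_finrank_eq

variable [Module.Finite k A]

/-- The comultiplication of the dual is the transpose of multiplication and its counit is evaluation
at `1`, so being group-like means being multiplicative and unital. -/
theorem isGroupLikeElem_iff_exists_ofAlgHom (f : HopfDual k A) :
    IsGroupLikeElem k f ↔ ∃ φ : A →ₐ[k] k, ofAlgHom φ = f := by
  constructor
  · intro hf
    refine ⟨AlgHom.ofLinearMap (toDual k A f) hf.counit_eq_one fun a b => ?_, rfl⟩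
    have := pairing_coalgebra_comul f (a ⊗ₜ[k] b)
    rw [hf.comul_eq_tmul_self, pairing_tmul] at this
    simpa using this.symm
  · rintro ⟨φ, rfl⟩
    refine ⟨map_one φ, pairing_ext fun a b => ?_⟩
    rw [pairing_coalgebra_comul, pairing_tmul]
    simp

theorem centralGroupLikes_eq_image :
    centralGroupLikes k (HopfDual k A) = ofAlgHom ''
      {φ : A →ₐ[k] k | ∀ a : A,
        leftSlice φ (Coalgebra.comul a) = rightSlice φ (Coalgebra.comul a)} := by
  ext f
  simp only [centralGroupLikes, Set.mem_inter_iff, Set.mem_ofPred_eq, Set.mem_image,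
    isGroupLikeElem_iff_exists_ofAlgHom]
  constructor
  · rintro ⟨⟨φ, rfl⟩, h⟩
    exact ⟨φ, (ofAlgHom_mem_center_iff φ).1 h, rfl⟩
  · rintro ⟨φ, h, rfl⟩
    exact ⟨⟨φ, rfl⟩, (ofAlgHom_mem_center_iff φ).2 h⟩

end HopfDual

/-! ### Dimensions as cardinalities -/

/-- Distinct group-like elements over a field are linearly independent. In finite dimension this
also makes the set finite, so that `ncard` is a genuine count. -/
theorem finrank_centralGroupLikeSpan (k B : Type*) [Field k] [Ring B] [HopfAlgebra k B]
    [Module.Finite k B] :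
    Module.finrank k (centralGroupLikeSpan k B) = (centralGroupLikes k B).ncard := by
  have hli : LinearIndepOn k id (centralGroupLikes k B) :=
    linearIndepOn_isGroupLikeElem.mono Set.inter_subset_left
  have : Fintype (centralGroupLikes k B) :=
    @Fintype.ofFinite _ hli.finite
  rw [centralGroupLikeSpan, finrank_span_set_eq_card hli, Set.ncard_eq_toFinset_card']

namespace HopfTwist

open HopfDual

variable {k A : Type*} [Field k] [Ring A] [HopfAlgebra k A]

theorem finrank_dual (J : HopfTwist k A) :
    Module.finrank k (HopfDual k J.Twisted) = Module.finrank k A :=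
  HopfDual.finrank_eq k J.Twisted

variable [Module.Finite k A]

theorem finrank_centralGroupLikeSpan_dual (J : HopfTwist k A) :
    Module.finrank k (centralGroupLikeSpan k (HopfDual k J.Twisted)) =
      {φ : A →ₐ[k] k | ∀ a : A, leftSlice φ (J.comul a) = rightSlice φ (J.comul a)}.ncard := by
  have : Module.Finite k (HopfDual k J.Twisted) :=
    Module.Finite.equiv (toDual k J.Twisted).symm
  rw [finrank_centralGroupLikeSpan, centralGroupLikes_eq_image,
    Set.ncard_image_of_injective _ ofAlgHom_injective]
  -- `J.Twisted` has the same underlying algebra as `A`, hence the same algebra maps to `k`, and its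
  -- comultiplication is `J.comul` by definition.
  rfl

end HopfTwist

/-! ### The alternating bicharacter of a cocycle -/

namespace NormalizedTwoCocycle

variable {Γ M : Type*} [CommGroup Γ] [CommGroup M]

/-- The alternating bicharacter `β ↦ ω(β, χ) / ω(χ, β)` of a 2-cocycle on an abelian group. -/
def alternator (ω : NormalizedTwoCocycle Γ M) (χ : Γ) : Γ →* M where
  toFun β := ω.toFun β χ / ω.toFun χ β
  map_one' := by simp [ω.one_left, ω.one_right]
  map_mul' β γ := by
    -- The cocycle identity is used with `χ` in the third, second and first place. Commutativity of
    -- `Γ` makes the three instances share terms, and in the quotient the factors `ω(β, γ)` and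
    -- `ω(βχ, γ)` cancel.
    have h1 := ω.cocycle β γ χ
    have h2 := ω.cocycle β χ γ
    have h3 := ω.cocycle χ β γ
    rw [mul_comm χ β] at h3
    rw [mul_comm χ γ] at h2
    have e1 : ω.toFun (β * γ) χ = ω.toFun β (γ * χ) * ω.toFun γ χ / ω.toFun β γ :=
      eq_div_of_mul_eq' h1
    have e2 : ω.toFun χ (β * γ) = ω.toFun (β * χ) γ * ω.toFun χ β / ω.toFun β γ :=
      eq_div_of_mul_eq' h3.symm
    have e3 : ω.toFun β (γ * χ) = ω.toFun (β * χ) γ * ω.toFun β χ / ω.toFun χ γ :=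
      eq_div_of_mul_eq' h2.symm
    rw [e1, e2, e3, div_div_div_cancel_right, div_mul_eq_mul_div, div_div, div_mul_div_comm,
      mul_assoc, mul_left_comm (ω.toFun χ γ), mul_div_mul_left_eq_div, mul_comm (ω.toFun χ γ)]

theorem alternator_apply (ω : NormalizedTwoCocycle Γ M) (χ β : Γ) :
    ω.alternator χ β = ω.toFun β χ / ω.toFun χ β := rfl

theorem alternator_eq_one_iff (ω : NormalizedTwoCocycle Γ M) (χ : Γ) :
    ω.alternator χ = 1 ↔ ω.IsRegular χ := by
  rw [MonoidHom.ext_iff]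
  simp only [alternator_apply, MonoidHom.one_apply, div_eq_one]
  exact forall_congr' fun β => eq_comm

end NormalizedTwoCocycle

/-! ### Counting the characters trivial on a subgroup -/

/-- The characters of a finite group that are trivial on `H` are those of the quotient of the
abelianization by the image of `H`. -/
theorem card_monoidHom_le_ker {k G : Type*} [Field k] [IsAlgClosed k] [CharZero k] [Group G]
    [Finite G] (H : Subgroup G) :
    {χ : G →* kˣ | H ≤ χ.ker}.ncard = (H ⊔ commutator G).index := by
  let K : Subgroup (Abelianization G) := H.map Abelianization.of
  -- Duality for the finite abelian group `Abelianization G`: the annihilator of `K` is the dual of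
  -- the quotient by `K`. It needs enough roots of unity in `k`.
  have hK : Nat.card (MonoidHom.domRestrictHom K kˣ).ker = Nat.card (Abelianization G ⧸ K) :=
    CommGroup.card_domRestrictHom_ker k K
  have hsurj : Function.Surjective (Abelianization.of (G := G)) := QuotientGroup.mk_surjective
  -- The preimage of `K` in `G` is the join of `H` with the kernel of abelianization, which is the
  -- commutator subgroup.
  have hindex : (H ⊔ commutator G).index = K.index := by
    rw [Subgroup.index_map, MonoidHom.range_eq_top_of_surjective _ hsurj, Subgroup.index_top,
      mul_one, Abelianization.ker_of]
  have himage : {χ : G →* kˣ | H ≤ χ.ker} = Abelianization.lift.symm ''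
      ((MonoidHom.domRestrictHom K kˣ).ker : Set (Abelianization G →* kˣ)) := by
    ext χ
    obtain ⟨ψ, rfl⟩ := Abelianization.lift.symm.surjective χ
    rw [Abelianization.lift.symm.injective.mem_set_image, SetLike.mem_coe, MonoidHom.mem_ker,
      MonoidHom.domRestrictHom_apply, MonoidHom.domRestrict_eq_one_iff]
    exact (Subgroup.map_le_iff_le_comap (f := Abelianization.of) (K := H) (H := ψ.ker)).symm
  rw [himage, Set.ncard_image_of_injective _ Abelianization.lift.symm.injective, hindex]
  exact hK

/-! ### Slices of the abelian twist and the centrality criterion -/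

namespace GroupTwist

open HopfDual

variable {k G : Type*} [Field k] [Group G]

/-- Characters of a group are the same as characters of its group algebra. -/
noncomputable def charEquiv : (G →* kˣ) ≃ (MonoidAlgebra k G →ₐ[k] k) :=
  (Equiv.mk (fun χ : G →* kˣ => (Units.coeHom k).comp χ) MonoidHom.toHomUnits
    (fun _ => by ext; rfl) (fun _ => rfl)).trans (MonoidAlgebra.lift k k G)

theorem charEquiv_single (χ : G →* kˣ) (g : G) (a : k) :
    charEquiv χ (MonoidAlgebra.single g a) = a * χ g := by
  refine (MonoidAlgebra.lift_single _ _ _).trans ?_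
  rw [smul_eq_mul]
  rfl

/-- Slicing by a character is an algebra map, so it passes through $J^{-1} (g \otimes g) J$ factor
by factor, sending $g \otimes g$ to $\chi(g) g$. -/
theorem leftSlice_comul_single (J : HopfTwist k (MonoidAlgebra k G)) (χ : G →* kˣ) (g : G) :
    leftSlice (charEquiv χ) (J.comul (MonoidAlgebra.single g 1)) =
      (χ g : k) • (leftSlice (charEquiv χ) (J.val⁻¹).val * MonoidAlgebra.single g 1 *
        leftSlice (charEquiv χ) J.val.val) := by
  -- `MonoidAlgebra.smul_single` would absorb the scalar `χ g` into the coefficient; it has to stay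
  -- outside the product.
  simp [-MonoidAlgebra.smul_single, HopfTwist.comul_apply, charEquiv_single]

theorem rightSlice_comul_single (J : HopfTwist k (MonoidAlgebra k G)) (χ : G →* kˣ) (g : G) :
    rightSlice (charEquiv χ) (J.comul (MonoidAlgebra.single g 1)) =
      (χ g : k) • (rightSlice (charEquiv χ) (J.val⁻¹).val * MonoidAlgebra.single g 1 *
        rightSlice (charEquiv χ) J.val.val) := by
  simp [-MonoidAlgebra.smul_single, HopfTwist.comul_apply, charEquiv_single]

variable [Finite G] [IsAlgClosed k] [CharZero k] (H : Subgroup G)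

open Classical in
-- Orthogonality of the characters `α` and `χ|_H` of `H`. Hence each slice of `J` picks out a single
-- row or column of `ω`.
theorem charEquiv_charIdem (χ : G →* kˣ) (α : H →* kˣ) :
    charEquiv χ (charIdem H α) = if α = χ.comp H.subtype then 1 else 0 := by
  have := Fintype.ofFinite H
  have h := sum_char_inv H (α * (χ.comp H.subtype)⁻¹)
  simp only [char_mul_inv_eq_one] at h
  rw [charIdem_eq]
  simp only [map_smul, map_sum, charEquiv_single, smul_eq_mul, one_mul]
  have e : ∑ x : H, ((α x⁻¹ : kˣ) : k) * (χ x : k) =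
      if α = χ.comp H.subtype then (Nat.card H : k) else 0 := by
    rw [← h]
    refine Finset.sum_congr rfl fun x _ => ?_
    simp
  rw [e]
  split_ifs
  · exact inv_mul_cancel₀ (card_ne_zero H)
  · simp

variable {H}

theorem leftSlice_pairSum [Fintype (H →* kˣ)] (χ : G →* kˣ)
    (f : (H →* kˣ) → (H →* kˣ) → k) :
    leftSlice (charEquiv χ) (pairSum (charIdem H) f) =
      ∑ β, f (χ.comp H.subtype) β • charIdem H β := by
  classical
  -- The index that the slice collapses must be summed innermost.
  rw [pairSum_eq, Finset.sum_comm]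
  simp [charEquiv_charIdem, ite_smul, smul_ite]

theorem rightSlice_pairSum [Fintype (H →* kˣ)] (χ : G →* kˣ)
    (f : (H →* kˣ) → (H →* kˣ) → k) :
    rightSlice (charEquiv χ) (pairSum (charIdem H) f) =
      ∑ α, f α (χ.comp H.subtype) • charIdem H α := by
  classical
  simp [pairSum_eq, charEquiv_charIdem, ite_smul, smul_ite]

/-- The `charIdem H β` are orthogonal idempotents, so coefficients multiply pointwise. -/
theorem sum_smul_charIdem_mul [Fintype (H →* kˣ)] (f g : (H →* kˣ) → k) :
    (∑ β, f β • charIdem H β) * ∑ β, g β • charIdem H β =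
      ∑ β, (f β * g β) • charIdem H β := by
  classical
  simp [Finset.sum_mul_sum, charIdem_mul, smul_smul, mul_comm]

variable [IsMulCommutative H]

/-- Fourier inversion: `h` acts on each `charIdem H χ` by the scalar `χ h`, and these idempotents
sum to `1`. -/
theorem sum_apply_smul_charIdem [Fintype (H →* kˣ)] (h : H) :
    ∑ χ : H →* kˣ, ((χ h : kˣ) : k) • charIdem H χ = MonoidAlgebra.single (h : G) (1 : k) := by
  simp_rw [← single_mul_charIdem, ← Finset.mul_sum, sum_charIdem, mul_one]

theorem abelianTwist_inv (ω : NormalizedTwoCocycle (H →* kˣ) kˣ) :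
    ((abelianTwist ω).val⁻¹).val =
      pairSum (charIdem H) (fun α β => (((ω.toFun α β)⁻¹ : kˣ) : k)) := rfl

open IsMulCommutative in
-- The heart of the proof. With $L$, $R$ the left and right slices of $J$ by `χ`, equality on all of
-- $kG$ says that $R L^{-1}$ is central; this quotient is an element of $H$, so the trivial center
-- of $G$ applies to it.
theorem slices_comul_eq_iff (hZ : Subgroup.center G = ⊥)
    (ω : NormalizedTwoCocycle (H →* kˣ) kˣ) (hω : ω.IsNondegenerate) (χ : G →* kˣ) :
    (∀ a, leftSlice (charEquiv χ) ((abelianTwist ω).comul a) =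
      rightSlice (charEquiv χ) ((abelianTwist ω).comul a)) ↔ H ≤ χ.ker := by
  have := Fintype.ofFinite (H →* kˣ)
  have hres : H ≤ χ.ker ↔ χ.comp H.subtype = 1 := by
    rw [MonoidHom.ext_iff, Subtype.forall]
    rfl
  rw [hres]
  constructor
  · intro hc
    apply hω
    rw [← ω.alternator_eq_one_iff]
    set ξ := χ.comp H.subtype with hξ
    -- A finite abelian group is its own double dual, so the character `ω.alternator ξ` of the dual
    -- of `H` is evaluation at some `h`.
    obtain ⟨h, hh⟩ : ∃ h : H, ∀ β : H →* kˣ, β h = ω.alternator ξ β :=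
      ⟨CommGroup.monoidHomMonoidHomEquiv H k (ω.alternator ξ),
        fun β => CommGroup.apply_monoidHomMonoidHomEquiv k β _⟩
    have hmem : (h : G) ∈ Subgroup.center G := by
      rw [Subgroup.mem_center_iff]
      intro g
      have hg := hc (MonoidAlgebra.single g 1)
      rw [leftSlice_comul_single, rightSlice_comul_single,
        (Units.isUnit (χ g)).smul_left_cancel, abelianTwist_inv, abelianTwist_val,
        leftSlice_pairSum, leftSlice_pairSum, rightSlice_pairSum, rightSlice_pairSum,
        ← hξ] at hg
      -- Fourier inversion identifies $R L^{-1}$ with `h`.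
      have hD : (MonoidAlgebra.single (h : G) (1 : k)) =
          ∑ β, ((ω.toFun β ξ : k) * (((ω.toFun ξ β)⁻¹ : kˣ) : k)) • charIdem H β := by
        rw [← sum_apply_smul_charIdem h]
        simp [hh, ω.alternator_apply, div_eq_mul_inv]
      have h1 : (MonoidAlgebra.single (h : G) (1 : k)) * MonoidAlgebra.single g 1 =
          MonoidAlgebra.single g 1 * MonoidAlgebra.single (h : G) (1 : k) := by
        -- Multiplying $L^{-1} g L = R^{-1} g R$ by $R$ on the left and by $L^{-1}$ on the right
        -- gives $(R L^{-1}) g = g (R L^{-1})$.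
        have := congrArg (fun x => (∑ β, (ω.toFun β ξ : k) • charIdem H β) * x *
          ∑ β, (((ω.toFun ξ β)⁻¹ : kˣ) : k) • charIdem H β) hg
        -- Associating to the right lets the sums after `g` merge; associating to the left then
        -- merges those before it.
        simp only [mul_assoc] at this
        simp only [sum_smul_charIdem_mul] at this
        simp only [← mul_assoc, sum_smul_charIdem_mul] at this
        rw [← hD] at this
        simpa [sum_charIdem] using this
      rw [MonoidAlgebra.single_mul_single, MonoidAlgebra.single_mul_single] at h1
      exact (MonoidAlgebra.single_left_injective (by simp) h1).symm
    rw [hZ, Subgroup.mem_bot, OneMemClass.coe_eq_one] at hmem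
    ext β
    rw [← hh, hmem, map_one, MonoidHom.one_apply]
  · intro hχ a
    -- Both sides are algebra maps, so comparison on group elements suffices. When `χ` is trivial on
    -- `H`, normalization of `ω` makes every slice of `J` and of its inverse equal to `1`, and both
    -- sides send `g` to `χ g • g`.
    have key : (leftSlice (charEquiv χ)).comp (abelianTwist ω).comul =
        (rightSlice (charEquiv χ)).comp (abelianTwist ω).comul := by
      refine MonoidAlgebra.algHom_ext (fun g => ?_) (by ext)
      simp [sum_charIdem, leftSlice_comul_single, rightSlice_comul_single, abelianTwist_inv,
        abelianTwist_val, leftSlice_pairSum, rightSlice_pairSum, hχ, ω.one_left, ω.one_right]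
    exact DFunLike.congr_fun key a

theorem finrank_centralGroupLikeSpan_dual_abelianTwist (hZ : Subgroup.center G = ⊥)
    (ω : NormalizedTwoCocycle (H →* kˣ) kˣ) (hω : ω.IsNondegenerate) :
    Module.finrank k (centralGroupLikeSpan k (HopfDual k (abelianTwist ω).Twisted)) =
      (H ⊔ commutator G).index := by
  rw [HopfTwist.finrank_centralGroupLikeSpan_dual, ← card_monoidHom_le_ker (k := k),
    ← Set.ncard_image_of_injective _ (charEquiv (k := k) (G := G)).injective]
  congr 1
  ext φ
  obtain ⟨χ, rfl⟩ := charEquiv.surjective φ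
  rw [charEquiv.injective.mem_set_image]
  exact slices_comul_eq_iff hZ ω hω χ

end GroupTwist

theorem mainTheorem11 {k : Type*} [Field k] [IsAlgClosed k] [CharZero k]
    {G : Type*} [Group G] [Finite G] (hZ : Subgroup.center G = ⊥)
    (H : Subgroup G) [IsMulCommutative H]
    (ω : NormalizedTwoCocycle (H →* kˣ) kˣ) (hω : ω.IsNondegenerate) :
    Module.finrank k (centralGroupLikeSpan k (HopfDual k (GroupTwist.abelianTwist ω).Twisted)) ∣
        Module.finrank k (HopfDual k (GroupTwist.abelianTwist ω).Twisted) ∧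
      Nat.card H ∣
        Module.finrank k (HopfDual k (GroupTwist.abelianTwist ω).Twisted) /
          Module.finrank k
            (centralGroupLikeSpan k (HopfDual k (GroupTwist.abelianTwist ω).Twisted)) := by
  rw [GroupTwist.finrank_centralGroupLikeSpan_dual_abelianTwist hZ ω hω, HopfTwist.finrank_dual,
    Module.finrank_eq_nat_card_basis (MonoidAlgebra.basis G k),
    -- Writing $|G| = |HG'| \cdot [G : HG']$ shows that the quotient of dimensions is exactly
    -- $|HG'|$; finiteness of `G` makes the index nonzero, so the natural-number division is exact.
    ← (H ⊔ commutator G).card_mul_index]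
  refine ⟨Dvd.intro_left _ rfl, ?_⟩
  rw [Nat.mul_div_cancel _ (Nat.pos_of_ne_zero Subgroup.index_ne_zero_of_finite)]
  exact Subgroup.card_dvd_of_le le_sup_left
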